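/- For a complex Hilbert space $E$ (for instance $\mathbb{C}^d$ or $\ell^2$) with open unit ball $\mathbb{B}_E$, let $\mathcal{H}_E$ be Drury--Arveson space, the Hilbert space of functions on $\mathbb{B}_E$ with reproducing kernel $k(x,y)=k_y(x)=\frac{1}{1-\langle x,y\rangle}$, and let $\mathcal{M}_E$ be its multiplier algebra, that is, the algebra of all functions $f$ on $\mathbb{B}_E$ with $f\mathcal{H}_E\subseteq\mathcal{H}_E$. A variety in $\mathbb{B}_E$ is the common zero set in $\mathbb{B}_E$ of a family of functions in $\mathcal{M}_E$. For a variety $V$ let $\mathcal{H}_V=\overline{\operatorname{span}}\{k_y:y\in V\}$, considered as a space of functions on $V$, and let $\mathcal{M}_V$ be its multiplier algebra, an algebra of functions on $V$. A map from a subset of a Hilbert space into a Hilbert space is holomorphic if near each point of its domain it is the restriction of a holomorphic (Fréchet differentiable) map defined on a ball around that point in the ambient Hilbert space; a biholomorphism is a bijection that is holomorphic together with its inverse. The pseudohyperbolic distance on $\mathbb{B}_E$ is $d(z,w)=\|\varphi_w(z)\|$, where \[ \varphi_w(z)=\frac{w-P_wz-(1-\|w\|^2)^{1/2}P_w^\perp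 z}{1-\langle z,w\rangle} \] and $P_w$ is the orthogonal projection onto $\mathbb{C}w$. Theorem. Let $V$ and $W$ be varieties in the open unit balls of complex Hilbert spaces $E$ and $E'$, and suppose that $\phi:\mathcal{M}_V\to\mathcal{M}_W$ is an algebra isomorphism induced by a biholomorphism $F:W\to V$, that is, $\phi(f)=f\circ F$ for all $f\in\mathcal{M}_V$. Then there are constants $c,C>0$ such that \[ c\,d(\lambda,\mu)\le d(F(\lambda),F(\mu))\le C\,d(\lambda,\mu)\quad\text{for all }\lambda,\mu\in W. \] -/

import Mathlib

open scoped ComplexConjugate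

noncomputable section

namespace DruryArveson

/-- The open unit ball of a complex Hilbert space. -/
abbrev UnitBall (E : Type*) [NormedAddCommGroup E] : Type _ :=
  ↥(Metric.ball (0 : E) 1)

section Kernel

variable (E : Type*) [NormedAddCommGroup E] [InnerProductSpace ℂ E]

/-- The reproducing kernel `k(x, y) = 1 / (1 - ⟨x, y⟩)`, where `⟨x, y⟩` is linear in `x`, that is,
`inner ℂ y x` in Mathlib. Scalars are viewed as operators on `ℂ`. -/
def kernel : Matrix (UnitBall E) (UnitBall E) (ℂ →L[ℂ] ℂ) :=
  .of fun x y => (1 - inner ℂ (y : E) (x : E))⁻¹ • 1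

variable {E}

theorem norm_inner_lt_one (x y : UnitBall E) : ‖inner ℂ (x : E) (y : E)‖ < 1 := by
  have hx : ‖(x : E)‖ < 1 := mem_ball_zero_iff.mp x.2
  have hy : ‖(y : E)‖ < 1 := mem_ball_zero_iff.mp y.2
  calc ‖inner ℂ (x : E) (y : E)‖ ≤ ‖(x : E)‖ * ‖(y : E)‖ := norm_inner_le_norm _ _
    _ < 1 := by nlinarith [norm_nonneg (x : E), norm_nonneg (y : E)]

open scoped ComplexOrder in
theorem posSemidef_pow {ι : Type*} [Finite ι] (v : ι → E) (n : ℕ) :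
    (Matrix.of fun i j => (inner ℂ (v i) (v j)) ^ n).PosSemidef := by
  induction n with
  | zero =>
    convert! Matrix.posSemidef_gram ℂ (fun _ : ι => (1 : ℂ)) using 1
    ext i j
    simp [Matrix.gram]
  | succ n ih =>
    convert! ih.hadamard (Matrix.posSemidef_gram ℂ v) using 1

open scoped ComplexOrder in
theorem sum_pow_nonneg (s : Finset (UnitBall E)) (w : UnitBall E → ℂ) (n : ℕ) :
    0 ≤ (∑ x ∈ s, ∑ y ∈ s, conj (w x) * (inner ℂ (y : E) (x : E)) ^ n * w y).re := by
  have h := (posSemidef_pow (fun i : s => ((i : UnitBall E) : E)) n).transpose.dotProduct_mulVec_nonneg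
    (fun i => w i)
  have h' := (Complex.le_def.mp h).1
  simp only [dotProduct, Matrix.mulVec, Pi.star_apply, Matrix.transpose_apply, Matrix.of_apply, Finset.mul_sum] at h'
  rw [← Finset.sum_coe_sort]
  simp only [← Finset.sum_coe_sort s (fun y => conj (w _) * (inner ℂ (y : E) _) ^ n * w y)]
  simpa [mul_assoc] using h'

theorem kernel_posSemidef : (kernel E).PosSemidef := by
  have h := (RKHS.posSemidef_tfae (K := kernel E)).out 0 2
  refine h.mpr (And.intro ?_ fun vv => ?_)
  · ext x y
    simp [kernel, Matrix.conjTranspose_apply]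
  · have key : HasSum (fun n : ℕ => ∑ x ∈ vv.support, ∑ x' ∈ vv.support,
        conj (vv x) * (inner ℂ (x' : E) (x : E)) ^ n * vv x')
        (vv.sum fun x w => vv.sum fun x' w' => inner ℂ (kernel E x' x w) w') := by
      refine hasSum_sum fun x _ => hasSum_sum fun x' _ => ?_
      have h := ((hasSum_geometric_of_norm_lt_one
        (norm_inner_lt_one x' x)).mul_left (conj (vv x))).mul_right (vv x')
      convert! h using 1
      simp [kernel]
      ring
    exact (Complex.hasSum_re key).nonneg fun n => sum_pow_nonneg vv.support vv n

instance : Fact (kernel E).PosSemidef := ⟨kernel_posSemidef⟩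

end Kernel

section Spaces

variable (E : Type*) [NormedAddCommGroup E] [InnerProductSpace ℂ E]

/-- Drury--Arveson space: the Hilbert space of functions on the unit ball of `E` with reproducing
kernel `1 / (1 - ⟨x, y⟩)`. -/
abbrev Space : Type _ := RKHS.OfKernel (kernel E)

variable {E}

/-- The kernel function `k_y`. -/
def kernelFun (y : UnitBall E) : Space E := RKHS.kerFun (Space E) y 1

theorem kernelFun_apply (x y : UnitBall E) :
    kernelFun y x = 1 / (1 - inner ℂ (y : E) (x : E)) := by
  rw [kernelFun, RKHS.kerFun_apply, RKHS.OfKernel.kernel_ofKernel]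
  simp [kernel]

/-- The closed subspace `H_V` of Drury--Arveson space spanned by the kernel functions `k_y`,
`y ∈ V`. -/
def subspaceOf (V : Set (UnitBall E)) : Submodule ℂ (Space E) :=
  (Submodule.span ℂ (kernelFun '' V)).topologicalClosure

/-- Drury--Arveson space as a space of functions on the ball. -/
def functions (E : Type*) [NormedAddCommGroup E] [InnerProductSpace ℂ E] :
    Submodule ℂ (UnitBall E → ℂ) :=
  LinearMap.range (RKHS.coeCLM ℂ : Space E →L[ℂ] (UnitBall E → ℂ)).toLinearMap

/-- The space `H_V` as a space of functions on `V`. -/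
def functionsOn (V : Set (UnitBall E)) : Submodule ℂ (V → ℂ) :=
  (subspaceOf V).map ((LinearMap.funLeft ℂ ℂ (Subtype.val : V → UnitBall E)).comp
    (RKHS.coeCLM ℂ : Space E →L[ℂ] (UnitBall E → ℂ)).toLinearMap)

end Spaces

/-- The algebra of multipliers of a space `H` of complex functions on `X`: all functions `f`
on `X` with `f * h ∈ H` for all `h ∈ H`. -/
def multipliers {X : Type*} (H : Submodule ℂ (X → ℂ)) : Subalgebra ℂ (X → ℂ) where
  carrier := {f | ∀ h ∈ H, f * h ∈ H}
  mul_mem' {f g} hf hg h hh := by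
    rw [mul_assoc]
    exact hf _ (hg _ hh)
  add_mem' {f g} hf hg h hh := by
    rw [add_mul]
    exact H.add_mem (hf _ hh) (hg _ hh)
  algebraMap_mem' c h hh := by
    rw [← Algebra.smul_def]
    exact H.smul_mem c hh

section Varieties

variable {E : Type*} [NormedAddCommGroup E] [InnerProductSpace ℂ E]

/-- A variety: the common zero set in the ball of a family of multipliers of Drury--Arveson
space. -/
def IsVariety (V : Set (UnitBall E)) : Prop :=
  ∃ S : Set (UnitBall E → ℂ), S ⊆ multipliers (functions E) ∧ V = {z | ∀ h ∈ S, h z = 0}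

/-- The multiplier algebra `M_V` of `H_V`, an algebra of functions on `V`. -/
abbrev multiplierAlgebra (V : Set (UnitBall E)) : Subalgebra ℂ (V → ℂ) :=
  multipliers (functionsOn V)

/-- A map defined on a subset `V` of the ball is holomorphic if it is locally the restriction of
a holomorphic map defined on a ball of the ambient Hilbert space. -/
def HolomorphicOn {E' : Type*} [NormedAddCommGroup E'] [NormedSpace ℂ E']
    (V : Set (UnitBall E)) (F : V → E') : Prop :=
  ∀ v : V, ∃ r > 0, ∃ g : E → E', DifferentiableOn ℂ g (Metric.ball ((v : UnitBall E) : E) r) ∧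
    ∀ u : V, ((u : UnitBall E) : E) ∈ Metric.ball ((v : UnitBall E) : E) r →
      g ((u : UnitBall E) : E) = F u

/-- A biholomorphism: a bijection that is holomorphic together with its inverse. -/
def IsBiholomorphism {E' : Type*} [NormedAddCommGroup E'] [InnerProductSpace ℂ E']
    {W : Set (UnitBall E)} {V : Set (UnitBall E')} (F : W ≃ V) : Prop :=
  HolomorphicOn W (fun w => ((F w : UnitBall E') : E')) ∧
    HolomorphicOn V (fun v => ((F.symm v : UnitBall E) : E))

/-- The conformal automorphism `φ_w` of the ball interchanging `w` and `0`:
`φ_w(z) = (w - P_w z - (1 - ‖w‖²)^{1/2} P_w^⊥ z) / (1 - ⟨z, w⟩)`, with `P_w` the orthogonal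
projection onto `ℂ w`. -/
def ballAut (w z : E) : E :=
  (1 - inner ℂ w z)⁻¹ •
    (w - (ℂ ∙ w).starProjection z
      - ((Real.sqrt (1 - ‖w‖ ^ 2) : ℝ) : ℂ) • (z - (ℂ ∙ w).starProjection z))

/-- The pseudohyperbolic distance `d(z, w) = ‖φ_w(z)‖` on the unit ball. -/
def pseudohyperbolicDist (z w : UnitBall E) : ℝ := ‖ballAut (w : E) (z : E)‖

end Varieties

end DruryArveson

end

/-!
By the closed graph theorem, composition with `F` is bounded from the multipliers on `V` to those
on `W`, and the open mapping theorem bounds preimages. The pseudohyperbolic distance is the sine of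
the angle between kernel functions, so a multiplier `f` vanishing at `y` satisfies the Schwarz-Pick
inequality `|f x| ≤ ‖f‖ * d(x, y)`. Equality holds for the component in the direction `φ_y x` of the
ball automorphism `φ_y`, which is a contractive multiplier because `(1 - ⟨φ_y z, φ_y w⟩) * k(z, w)`
is a positive kernel of rank one. Applying the inequality to composites of such extremal functions
gives the upper bound, and applying it to their bounded preimages gives the lower one.
-/

noncomputable section

open scoped ComplexOrder InnerProductSpace Matrix

namespace DruryArveson

section Factorization

variable {𝕜 A B Z : Type*} [NontriviallyNormedField 𝕜]
  [NormedAddCommGroup A] [NormedSpace 𝕜 A] [CompleteSpace A]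
  [NormedAddCommGroup B] [NormedSpace 𝕜 B] [CompleteSpace B]
  [AddCommGroup Z] [Module 𝕜 Z] [TopologicalSpace Z] [T2Space Z]

theorem exists_comp_eq_of_range_le {i : A →L[𝕜] Z} {j : B →L[𝕜] Z} (hj : Function.Injective j)
    (hij : i.range ≤ j.range) : ∃ R : A →L[𝕜] B, j ∘L R = i := by
  let R : A →ₗ[𝕜] B := (LinearEquiv.ofInjective j.toLinearMap hj).symm ∘ₗ
    i.toLinearMap.codRestrict j.range fun a => hij ⟨a, rfl⟩
  have hR (a : A) : j (R a) = i a :=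
    congrArg Subtype.val ((LinearEquiv.ofInjective j.toLinearMap hj).apply_symm_apply _)
  refine ⟨.ofSeqClosedGraph (g := R) fun u a b hu hRu => hj ?_, ContinuousLinearMap.ext hR⟩
  rw [hR]
  refine tendsto_nhds_unique ((j.continuous.tendsto b).comp hRu) ?_
  simpa only [Function.comp_def, hR] using (i.continuous.tendsto a).comp hu

end Factorization

section HilbertSpace

variable {𝕜 K ι : Type*} [RCLike 𝕜] [NormedAddCommGroup K] [InnerProductSpace 𝕜 K]

theorem norm_starProjection_orthogonal_singleton_sq (v w : K) :
    ‖(𝕜 ∙ v)ᗮ.starProjection w‖ ^ 2 = ‖w‖ ^ 2 - ‖⟪v, w⟫_𝕜‖ ^ 2 / ‖v‖ ^ 2 := by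
  have hproj : ‖(𝕜 ∙ v).starProjection w‖ ^ 2 = ‖⟪v, w⟫_𝕜‖ ^ 2 / ‖v‖ ^ 2 := by
    rw [Submodule.starProjection_singleton, norm_smul, norm_div]
    rcases eq_or_ne v 0 with rfl | hv
    · simp
    · have := norm_ne_zero_iff.mpr hv
      simp only [RCLike.norm_ofReal, abs_pow, abs_norm]
      field_simp
  have hpyth := Submodule.norm_sq_eq_add_norm_sq_projection w (𝕜 ∙ v)
  simp only [← Submodule.norm_coe, Submodule.coe_orthogonalProjectionOnto_apply] at hpyth
  rw [← hproj]
  linarith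

theorem inner_linearCombination_self (v : ι → K) (c : ι →₀ 𝕜) :
    ⟪Finsupp.linearCombination 𝕜 v c, Finsupp.linearCombination 𝕜 v c⟫_𝕜 =
      c.sum fun i a => c.sum fun j b => star a * Matrix.gram 𝕜 v i j * b := by
  rw [Finsupp.linearCombination_apply, Finsupp.sum_inner]
  refine Finsupp.sum_congr fun i _ => ?_
  rw [Finsupp.inner_sum]
  refine Finsupp.sum_congr fun j _ => ?_
  rw [inner_smul_left, inner_smul_right, Matrix.gram_apply, mul_comm (c j), ← mul_assoc,
    starRingEnd_apply]

variable (𝕜) in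
theorem posSemidef_gram (v : ι → K) : (Matrix.gram 𝕜 v).PosSemidef :=
  ⟨Matrix.isHermitian_gram 𝕜 v, fun c => by
    rw [← inner_linearCombination_self, inner_self_eq_norm_sq_to_K]
    exact pow_nonneg (RCLike.ofReal_nonneg.mpr (norm_nonneg _)) 2⟩

end HilbertSpace

section RKHS

variable {X H : Type*} [NormedAddCommGroup H] [InnerProductSpace ℂ H] [RKHS ℂ H X ℂ]

variable (H) in
/-- A reproducing kernel Hilbert space `H` as a space of functions. -/
def functionsOf : Submodule ℂ (X → ℂ) :=
  (RKHS.coeCLM ℂ : H →L[ℂ] X → ℂ).range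

/-- `T` is the operator of multiplication by the function `f` on a reproducing kernel Hilbert
space. -/
def IsMultiplicationBy (f : X → ℂ) (T : H →L[ℂ] H) : Prop :=
  ∀ h : H, ⇑(T h) = f * ⇑h

variable {f g : X → ℂ} {S T : H →L[ℂ] H}

theorem IsMultiplicationBy.zero : IsMultiplicationBy 0 (0 : H →L[ℂ] H) := fun h => by
  rw [zero_mul]
  exact RKHS.coe_zero

theorem IsMultiplicationBy.add (hS : IsMultiplicationBy f S) (hT : IsMultiplicationBy g T) :
    IsMultiplicationBy (f + g) (S + T) := fun h => by
  rw [_root_.add_apply, RKHS.coe_add, hS, hT, add_mul]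

theorem IsMultiplicationBy.smul (c : ℂ) (hT : IsMultiplicationBy f T) :
    IsMultiplicationBy (c • f) (c • T) := fun h => by
  rw [_root_.smul_apply, RKHS.coe_smul, hT, smul_mul_assoc]

theorem IsMultiplicationBy.unique (hS : IsMultiplicationBy f S) (hT : IsMultiplicationBy f T) :
    S = T :=
  ContinuousLinearMap.ext fun h => DFunLike.coe_injective ((hS h).trans (hT h).symm)

variable (H) in
/-- The Banach space of multiplication operators, with the operator norm. -/
def multiplicationOperators : Submodule ℂ (H →L[ℂ] H) where
  carrier := {T | ∃ f : X → ℂ, IsMultiplicationBy f T}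
  zero_mem' := ⟨0, .zero⟩
  add_mem' := fun ⟨_, hS⟩ ⟨_, hT⟩ => ⟨_, hS.add hT⟩
  smul_mem' c _ := fun ⟨_, hT⟩ => ⟨_, hT.smul c⟩

variable [CompleteSpace H]

theorem mem_multipliers_iff :
    f ∈ multipliers (functionsOf H) ↔ ∃ T : H →L[ℂ] H, IsMultiplicationBy f T := by
  constructor
  · intro hf
    let mulLeft : (X → ℂ) →L[ℂ] X → ℂ := .pi fun x => f x • .proj x
    obtain ⟨T, hT⟩ := exists_comp_eq_of_range_le (i := mulLeft ∘L RKHS.coeCLM ℂ)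
      (RKHS.coeCLM_injective (H := H)) <| by
        rintro _ ⟨h, rfl⟩
        exact hf _ ⟨h, rfl⟩
    exact ⟨T, fun h => DFunLike.congr_fun hT h⟩
  · rintro ⟨T, hT⟩ _ ⟨h, rfl⟩
    exact ⟨T h, hT h⟩

variable (H) in
/-- The reproducing kernel function `k_x` of a space of scalar functions: Mathlib's `RKHS.kerFun`
is an operator on the space of values, here `ℂ`. -/
def kernelAt (x : X) : H :=
  RKHS.kerFun H x 1

theorem inner_kernelAt_left (x : X) (h : H) : ⟪kernelAt H x, h⟫_ℂ = h x := by
  simp [kernelAt]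

theorem kernelAt_self (x : X) : kernelAt H x x = (‖kernelAt H x‖ : ℂ) ^ 2 := by
  rw [← inner_kernelAt_left, inner_self_eq_norm_sq_to_K]
  rfl

theorem kernelAt_self_ne_zero {x : X} (hx : kernelAt H x ≠ 0) : kernelAt H x x ≠ 0 := by
  rwa [← inner_kernelAt_left, inner_self_ne_zero]

theorem denseRange_linearCombination_kernelAt :
    DenseRange (Finsupp.linearCombination ℂ (kernelAt H : X → H)) := by
  have hrange :
      (Finsupp.linearCombination ℂ (kernelAt H : X → H)).range.topologicalClosure = ⊤ := by
    rw [eq_top_iff, ← RKHS.kerFun_dense H, Finsupp.range_linearCombination]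
    refine Submodule.topologicalClosure_mono (Submodule.span_le.mpr ?_)
    rintro _ ⟨x, v, rfl⟩
    have hv : RKHS.kerFun H x v = v • kernelAt H x := by
      rw [kernelAt, ← map_smul, smul_eq_mul, mul_one]
    exact hv ▸ Submodule.smul_mem _ v (Submodule.subset_span ⟨x, rfl⟩)
  exact Submodule.dense_iff_topologicalClosure_eq_top.mpr hrange

variable (H) in
/-- The Berezin transform `x ↦ ⟨T k_x, k_x⟩ / ⟨k_x, k_x⟩`, which recovers a multiplier from its
multiplication operator. -/
def berezinTransform : (H →L[ℂ] H) →L[ℂ] X → ℂ :=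
  .pi fun x => (kernelAt H x x)⁻¹ • .proj x ∘L RKHS.coeCLM ℂ ∘L .apply ℂ H (kernelAt H x)

theorem berezinTransform_apply (T : H →L[ℂ] H) (x : X) :
    berezinTransform H T x = (kernelAt H x x)⁻¹ * T (kernelAt H x) x :=
  rfl

theorem IsMultiplicationBy.berezinTransform_eq (hk : ∀ x, kernelAt H x ≠ 0)
    (hT : IsMultiplicationBy f T) : berezinTransform H T = f := by
  ext x
  rw [berezinTransform_apply, hT, Pi.mul_apply, mul_comm,
    mul_inv_cancel_right₀ (kernelAt_self_ne_zero (hk x))]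

theorem mem_multiplicationOperators_iff (hk : ∀ x, kernelAt H x ≠ 0) :
    T ∈ multiplicationOperators H ↔ IsMultiplicationBy (berezinTransform H T) T :=
  ⟨fun ⟨_, hT⟩ => (hT.berezinTransform_eq hk).symm ▸ hT, fun hT => ⟨_, hT⟩⟩

theorem isClosed_multiplicationOperators (hk : ∀ x, kernelAt H x ≠ 0) :
    IsClosed (multiplicationOperators H : Set (H →L[ℂ] H)) := by
  have hset : (multiplicationOperators H : Set (H →L[ℂ] H)) =
      ⋂ (h : H) (x : X), {T | T h x = berezinTransform H T x * h x} := by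
    ext T
    simp only [SetLike.mem_coe, mem_multiplicationOperators_iff hk, IsMultiplicationBy, funext_iff,
      Pi.mul_apply, Set.mem_iInter, Set.mem_ofPred_eq]
  rw [hset]
  refine isClosed_iInter fun h => isClosed_iInter fun x => isClosed_eq ?_ ?_
  · exact (RKHS.continuous_eval x).comp (by fun_prop)
  · fun_prop

theorem completeSpace_multiplicationOperators (hk : ∀ x, kernelAt H x ≠ 0) :
    CompleteSpace (multiplicationOperators H) :=
  (isClosed_multiplicationOperators hk).completeSpace_coe

variable (H) in
/-- The multiplier by which a multiplication operator acts. -/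
def symbol : multiplicationOperators H →L[ℂ] X → ℂ :=
  berezinTransform H ∘L (multiplicationOperators H).subtypeL

theorem isMultiplicationBy_symbol (hk : ∀ x, kernelAt H x ≠ 0) (T : multiplicationOperators H) :
    IsMultiplicationBy (symbol H T) (T : H →L[ℂ] H) :=
  (mem_multiplicationOperators_iff hk).mp T.2

theorem symbol_injective (hk : ∀ x, kernelAt H x ≠ 0) : Function.Injective (symbol H) :=
  fun S T hST => Subtype.ext <|
    (isMultiplicationBy_symbol hk S).unique (hST ▸ isMultiplicationBy_symbol hk T)

theorem IsMultiplicationBy.exists_symbol_eq (hk : ∀ x, kernelAt H x ≠ 0)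
    (hT : IsMultiplicationBy f T) : ∃ S : multiplicationOperators H, ↑S = T ∧ symbol H S = f :=
  ⟨⟨T, f, hT⟩, rfl, hT.berezinTransform_eq hk⟩

theorem range_symbol (hk : ∀ x, kernelAt H x ≠ 0) :
    (symbol H).range = (multipliers (functionsOf H)).toSubmodule := by
  ext f
  rw [Subalgebra.mem_toSubmodule, mem_multipliers_iff]
  constructor
  · rintro ⟨T, rfl⟩
    exact ⟨T, isMultiplicationBy_symbol hk T⟩
  · rintro ⟨T, hT⟩
    exact ⟨⟨T, f, hT⟩, hT.berezinTransform_eq hk⟩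

variable (H) in
/-- The distance on the underlying set of a reproducing kernel Hilbert space given by the sine of
the angle between kernel functions. -/
def kernelDist (x y : X) : ℝ :=
  ‖(ℂ ∙ kernelAt H y)ᗮ.starProjection (kernelAt H x)‖ / ‖kernelAt H x‖

theorem kernelDist_nonneg (x y : X) : 0 ≤ kernelDist H x y := by
  unfold kernelDist
  positivity

theorem kernelDist_sq {x y : X} (hx : kernelAt H x ≠ 0) :
    kernelDist H x y ^ 2 =
      1 - ‖kernelAt H x y‖ ^ 2 / (‖kernelAt H x‖ ^ 2 * ‖kernelAt H y‖ ^ 2) := by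
  have hx' : ‖kernelAt H x‖ ^ 2 ≠ 0 := pow_ne_zero 2 (norm_ne_zero_iff.mpr hx)
  rw [kernelDist, div_pow, norm_starProjection_orthogonal_singleton_sq, inner_kernelAt_left,
    sub_div, div_self hx', div_div, mul_comm (‖kernelAt H y‖ ^ 2)]

/-- Since `T k_x` vanishes at `y`, it is orthogonal to `k_y`, so `k_x` may be replaced by its
component orthogonal to `k_y` in `⟨T k_x, k_x⟩ = f x * ‖k_x‖²`. -/
theorem IsMultiplicationBy.norm_apply_le {x y : X} (hx : kernelAt H x ≠ 0)
    (hT : IsMultiplicationBy f T) (hy : f y = 0) : ‖f x‖ ≤ ‖T‖ * kernelDist H x y := by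
  set k := kernelAt H x
  set p := (ℂ ∙ kernelAt H y)ᗮ.starProjection k
  have hk : 0 < ‖k‖ := norm_pos_iff.mpr hx
  have horth : T k ∈ (ℂ ∙ kernelAt H y)ᗮ := by
    rw [Submodule.mem_orthogonal_singleton_iff_inner_right, inner_kernelAt_left, hT,
      Pi.mul_apply, hy, zero_mul]
  have hinner : ⟪p, T k⟫_ℂ = f x * (‖k‖ : ℂ) ^ 2 := by
    rw [Submodule.inner_starProjection_left_eq_right,
      Submodule.starProjection_eq_self_iff.mpr horth, inner_kernelAt_left, hT, Pi.mul_apply,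
      kernelAt_self]
  have hle : ‖f x‖ * ‖k‖ ^ 2 ≤ ‖p‖ * (‖T‖ * ‖k‖) := by
    calc ‖f x‖ * ‖k‖ ^ 2 = ‖⟪p, T k⟫_ℂ‖ := by simp [hinner]
      _ ≤ ‖p‖ * ‖T k‖ := norm_inner_le_norm p (T k)
      _ ≤ ‖p‖ * (‖T‖ * ‖k‖) := by gcongr; exact T.le_opNorm k
  rw [kernelDist, mul_div_assoc', le_div_iff₀ hk]
  refine le_of_mul_le_mul_right ?_ hk
  linarith

theorem norm_symbol_apply_le (hk : ∀ x, kernelAt H x ≠ 0) (T : multiplicationOperators H)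
    {x y : X} (hy : symbol H T y = 0) : ‖symbol H T x‖ ≤ ‖T‖ * kernelDist H x y :=
  (isMultiplicationBy_symbol hk T).norm_apply_le (hk x) hy

variable (H) in
/-- The two-point Pick property: for any two points, the extremal value `kernelDist H x y` in the
Schwarz-Pick inequality is attained by a contractive multiplier. -/
def HasTwoPointPickProperty : Prop :=
  ∀ x y : X, ∃ T : multiplicationOperators H,
    ‖T‖ ≤ 1 ∧ symbol H T y = 0 ∧ ‖symbol H T x‖ = kernelDist H x y

section Composition

variable {Y L : Type*} [NormedAddCommGroup L] [InnerProductSpace ℂ L] [RKHS ℂ L Y ℂ]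
  [CompleteSpace L] {G : Y → X}

theorem exists_compositionOperator (hkX : ∀ x, kernelAt H x ≠ 0) (hkY : ∀ y, kernelAt L y ≠ 0)
    (hG : ∀ f ∈ multipliers (functionsOf H), f ∘ G ∈ multipliers (functionsOf L)) :
    ∃ R : multiplicationOperators H →L[ℂ] multiplicationOperators L,
      ∀ T, symbol L (R T) = symbol H T ∘ G := by
  have := completeSpace_multiplicationOperators hkX
  have := completeSpace_multiplicationOperators hkY
  let precomp : (X → ℂ) →L[ℂ] Y → ℂ := .pi fun y => .proj (G y)
  obtain ⟨R, hR⟩ := exists_comp_eq_of_range_le (i := precomp ∘L symbol H)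
    (symbol_injective (H := L) hkY) <| by
      rintro _ ⟨T, rfl⟩
      rw [range_symbol hkY]
      exact hG _ ((range_symbol hkX).le ⟨T, rfl⟩)
  exact ⟨R, DFunLike.congr_fun hR⟩

theorem exists_kernelDist_comp_le (hkX : ∀ x, kernelAt H x ≠ 0) (hkY : ∀ y, kernelAt L y ≠ 0)
    (hpick : HasTwoPointPickProperty H)
    (hG : ∀ f ∈ multipliers (functionsOf H), f ∘ G ∈ multipliers (functionsOf L)) :
    ∃ C > 0, ∀ l m, kernelDist H (G l) (G m) ≤ C * kernelDist L l m := by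
  obtain ⟨R, hR⟩ := exists_compositionOperator hkX hkY hG
  refine ⟨‖R‖ + 1, by positivity, fun l m => ?_⟩
  obtain ⟨T, hT, hTm, hTl⟩ := hpick (G l) (G m)
  have hRT : ‖R T‖ ≤ ‖R‖ + 1 := (R.le_of_opNorm_le_of_le le_rfl hT).trans (by linarith)
  have hmul := norm_symbol_apply_le hkY (R T) (x := l) (y := m)
  rw [hR] at hmul
  calc kernelDist H (G l) (G m) = ‖symbol H T (G l)‖ := hTl.symm
    _ ≤ ‖R T‖ * kernelDist L l m := hmul hTm
    _ ≤ (‖R‖ + 1) * kernelDist L l m := by gcongr; exact kernelDist_nonneg l m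

/-- By the open mapping theorem the composition operator admits preimages of bounded norm. -/
theorem exists_le_kernelDist_comp (hkX : ∀ x, kernelAt H x ≠ 0) (hkY : ∀ y, kernelAt L y ≠ 0)
    (hpick : HasTwoPointPickProperty L)
    (hG : ∀ f ∈ multipliers (functionsOf H), f ∘ G ∈ multipliers (functionsOf L))
    (hsurj : ∀ g ∈ multipliers (functionsOf L), ∃ f ∈ multipliers (functionsOf H), f ∘ G = g) :
    ∃ c > 0, ∀ l m, c * kernelDist L l m ≤ kernelDist H (G l) (G m) := by
  have := completeSpace_multiplicationOperators hkX
  have := completeSpace_multiplicationOperators hkY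
  obtain ⟨R, hR⟩ := exists_compositionOperator hkX hkY hG
  have hRsurj : Function.Surjective R := fun S => by
    obtain ⟨f, hf, hfS⟩ := hsurj _ ((range_symbol hkY).le ⟨S, rfl⟩)
    obtain ⟨T, rfl⟩ := (range_symbol hkX).ge hf
    exact ⟨T, symbol_injective hkY ((hR T).trans hfS)⟩
  obtain ⟨C, hC, hpre⟩ := R.exists_preimage_norm_le hRsurj
  refine ⟨C⁻¹, inv_pos.mpr hC, fun l m => (inv_mul_le_iff₀ hC).mpr ?_⟩
  obtain ⟨S, hS, hSm, hSl⟩ := hpick l m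
  obtain ⟨T, rfl, hTC⟩ := hpre S
  rw [hR] at hSm hSl
  have hT : ‖T‖ ≤ C := hTC.trans (mul_le_of_le_one_right hC.le hS)
  calc kernelDist L l m = ‖symbol H T (G l)‖ := hSl.symm
    _ ≤ ‖T‖ * kernelDist H (G l) (G m) := norm_symbol_apply_le hkX T hSm
    _ ≤ C * kernelDist H (G l) (G m) := by gcongr; exact kernelDist_nonneg _ _

end Composition

section Contractive

variable {E : Type*} [NormedAddCommGroup E] [InnerProductSpace ℂ E]

variable (H) in
/-- A function `b` with values in a Hilbert space `E` is a contractive multiplier, from `H` to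
`H ⊗ E`, if `(1 - ⟨b x, b y⟩) * k(x, y)` is positive semidefinite; this criterion is taken as the
definition. -/
def IsContractiveMultiplier (b : X → E) : Prop :=
  (Matrix.gram ℂ (kernelAt H : X → H) ⊙ .of fun x y => 1 - ⟪b y, b x⟫_ℂ).PosSemidef

theorem IsContractiveMultiplier.exists_isMultiplicationBy (hf : IsContractiveMultiplier H f) :
    ∃ T : H →L[ℂ] H, IsMultiplicationBy f T ∧ ‖T‖ ≤ 1 := by
  let A := Finsupp.linearCombination ℂ fun x : X => star (f x) • kernelAt H x
  let B := Finsupp.linearCombination ℂ (kernelAt H : X → H)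
  have hquad (c : X →₀ ℂ) : c.sum (fun x a => c.sum fun y b => star a *
      (Matrix.gram ℂ (kernelAt H : X → H) ⊙ .of fun x y => 1 - ⟪f y, f x⟫_ℂ) x y * b) =
        ⟪B c, B c⟫_ℂ - ⟪A c, A c⟫_ℂ := by
    simp only [A, B, inner_linearCombination_self, ← Finsupp.sum_sub]
    refine Finsupp.sum_congr fun x _ => Finsupp.sum_congr fun y _ => ?_
    rw [Matrix.hadamard_apply, Matrix.of_apply, Matrix.gram_apply, Matrix.gram_apply,
      inner_smul_left, inner_smul_right, RCLike.inner_apply, starRingEnd_apply, starRingEnd_apply,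
      star_star]
    ring
  have hAB (c : X →₀ ℂ) : ‖A c‖ ≤ 1 * ‖B c‖ := by
    have hnonneg := hf.2 c
    rw [hquad, inner_self_eq_norm_sq_to_K, inner_self_eq_norm_sq_to_K, sub_nonneg] at hnonneg
    rw [one_mul]
    exact le_of_sq_le_sq (by exact_mod_cast hnonneg) (norm_nonneg _)
  have hdense : DenseRange B := denseRange_linearCombination_kernelAt
  have hadj (x : X) : A.extendOfNorm B (kernelAt H x) = star (f x) • kernelAt H x := by
    simpa [A, B] using LinearMap.extendOfNorm_eq hdense ⟨1, hAB⟩ (Finsupp.single x 1)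
  refine ⟨(A.extendOfNorm B).adjoint, fun h => funext fun x => ?_, ?_⟩
  · rw [← inner_kernelAt_left, ContinuousLinearMap.adjoint_inner_right, hadj, inner_smul_left,
      inner_kernelAt_left, Pi.mul_apply, starRingEnd_apply, star_star]
  · rw [LinearIsometryEquiv.norm_map]
    exact LinearMap.opNorm_extendOfNorm_le hdense zero_le_one hAB

theorem IsContractiveMultiplier.inner_left {b : X → E} (hb : IsContractiveMultiplier H b) {u : E}
    (hu : ‖u‖ = 1) : IsContractiveMultiplier H fun x => ⟪u, b x⟫_ℂ := by
  unfold IsContractiveMultiplier at hb ⊢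
  let c (x : X) : E := (ℂ ∙ u)ᗮ.starProjection (b x)
  have hc (x y : X) : ⟪c y, c x⟫_ℂ = ⟪b y, b x⟫_ℂ - ⟪⟪u, b y⟫_ℂ, ⟪u, b x⟫_ℂ⟫_ℂ := by
    rw [Submodule.inner_starProjection_left_eq_right,
      Submodule.starProjection_eq_self_iff.mpr (Submodule.starProjection_apply_mem _ _),
      Submodule.starProjection_orthogonal_val, Submodule.starProjection_unit_singleton ℂ hu,
      inner_sub_right, inner_smul_right, ← inner_conj_symm (b y) u,
      RCLike.inner_apply]
  have hgram := (posSemidef_gram ℂ (kernelAt H)).hadamard (posSemidef_gram ℂ c).transpose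
  convert! hb.add hgram using 1
  ext x y
  simp only [Matrix.hadamard_apply, Matrix.of_apply, Matrix.add_apply, Matrix.transpose_apply,
    Matrix.gram_apply, hc]
  ring

theorem hasTwoPointPickProperty_of_isContractiveMultiplier (hk : ∀ x, kernelAt H x ≠ 0)
    {b : X → X → E} (hb : ∀ y, IsContractiveMultiplier H (b y)) (hself : ∀ y, b y y = 0)
    (hnorm : ∀ x y, ‖b y x‖ = kernelDist H x y) : HasTwoPointPickProperty H := by
  intro x y
  rcases eq_or_ne (b y x) 0 with hzero | hne
  · refine ⟨0, by simp, by simp, ?_⟩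
    rw [← hnorm, hzero, map_zero, Pi.zero_apply, norm_zero, norm_zero]
  · set u : E := (‖b y x‖⁻¹ : ℂ) • b y x
    have hu : ‖u‖ = 1 := norm_smul_inv_norm hne
    obtain ⟨T, hT, hT1⟩ := ((hb y).inner_left hu).exists_isMultiplicationBy
    obtain ⟨S, rfl, hS⟩ := hT.exists_symbol_eq hk
    have hS_apply (z : X) : symbol H S z = ⟪u, b y z⟫_ℂ := congrFun hS z
    refine ⟨S, hT1, ?_, ?_⟩
    · rw [hS_apply, hself, inner_zero_right]
    · rw [hS_apply, ← hnorm, inner_smul_left, inner_self_eq_norm_sq_to_K]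
      simp [sq, hne]

end Contractive

end RKHS

section BallAutomorphisms

variable {E : Type*} [NormedAddCommGroup E]

theorem norm_sq_lt_one (x : UnitBall E) : ‖(x : E)‖ ^ 2 < 1 :=
  pow_lt_one₀ (norm_nonneg _) (mem_ball_zero_iff.mp x.2) two_ne_zero

theorem sqrt_one_sub_norm_sq_mul_self (a : UnitBall E) :
    (√(1 - ‖(a : E)‖ ^ 2) : ℂ) * √(1 - ‖(a : E)‖ ^ 2) = 1 - (‖(a : E)‖ : ℂ) ^ 2 := by
  exact_mod_cast Real.mul_self_sqrt (sub_nonneg.mpr (norm_sq_lt_one a).le)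

variable [InnerProductSpace ℂ E]

theorem one_sub_inner_ne_zero (x y : UnitBall E) : 1 - ⟪(x : E), (y : E)⟫_ℂ ≠ 0 := fun h =>
  (norm_inner_lt_one x y).ne (by rw [← sub_eq_zero.mp h, norm_one])

theorem ballAut_self (a : E) : ballAut a a = 0 := by
  rw [ballAut, Submodule.starProjection_eq_self_iff.mpr (Submodule.mem_span_singleton_self a),
    sub_self, smul_zero, sub_zero, smul_zero]

theorem one_sub_inner_ballAut (a w z : UnitBall E) :
    1 - ⟪ballAut (a : E) (w : E), ballAut (a : E) (z : E)⟫_ℂ =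
      (1 - (‖(a : E)‖ : ℂ) ^ 2) * (1 - ⟪(w : E), (z : E)⟫_ℂ) /
        ((1 - ⟪(w : E), (a : E)⟫_ℂ) * (1 - ⟪(a : E), (z : E)⟫_ℂ)) := by
  have hwa := one_sub_inner_ne_zero w a
  have haz := one_sub_inner_ne_zero a z
  have hsqrt := sqrt_one_sub_norm_sq_mul_self a
  rw [eq_div_iff (mul_ne_zero hwa haz)]
  simp only [ballAut, Submodule.starProjection_singleton, inner_smul_left, inner_smul_right,
    inner_sub_left, inner_sub_right, map_inv₀, map_sub, map_one, map_div₀, inner_conj_symm,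
    Complex.conj_ofReal, inner_self_eq_norm_sq_to_K, map_pow, Complex.coe_algebraMap]
  generalize (√(1 - ‖(a : E)‖ ^ 2) : ℂ) = s at hsqrt
  rcases eq_or_ne (a : E) 0 with ha | ha
  · simp only [ha, norm_zero, inner_zero_left, inner_zero_right, Complex.ofReal_zero, ne_eq,
      OfNat.ofNat_ne_zero, not_false_eq_true, zero_pow] at hsqrt ⊢
    linear_combination (-⟪(w : E), (z : E)⟫_ℂ) * hsqrt
  · have hnorm : (‖(a : E)‖ : ℂ) ≠ 0 := Complex.ofReal_ne_zero.mpr (norm_ne_zero_iff.mpr ha)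
    field_simp
    linear_combination (⟪(w : E), (a : E)⟫_ℂ * ⟪(a : E), (z : E)⟫_ℂ -
      ⟪(w : E), (z : E)⟫_ℂ * (‖(a : E)‖ : ℂ) ^ 2) * hsqrt

theorem pseudohyperbolicDist_sq (x y : UnitBall E) :
    pseudohyperbolicDist x y ^ 2 =
      1 - (1 - ‖(x : E)‖ ^ 2) * (1 - ‖(y : E)‖ ^ 2) / ‖1 - ⟪(x : E), (y : E)⟫_ℂ‖ ^ 2 := by
  have hinner := one_sub_inner_ballAut y x x
  have hconj : 1 - ⟪(y : E), (x : E)⟫_ℂ = conj (1 - ⟪(x : E), (y : E)⟫_ℂ) := by simp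
  rw [hconj, Complex.mul_conj', inner_self_eq_norm_sq_to_K, inner_self_eq_norm_sq_to_K] at hinner
  rw [eq_sub_iff_add_eq, ← eq_sub_iff_add_eq', mul_comm (1 - ‖(x : E)‖ ^ 2)]
  simp only [Complex.coe_algebraMap] at hinner
  rw [pseudohyperbolicDist]
  exact_mod_cast hinner.symm

end BallAutomorphisms

section Varieties

variable {E : Type*} [NormedAddCommGroup E] [InnerProductSpace ℂ E] {V : Set (UnitBall E)}

theorem inner_kernelFun_left (x : UnitBall E) (h : Space E) : ⟪kernelFun x, h⟫_ℂ = h x :=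
  inner_kernelAt_left x h

theorem kernelFun_mem_subspaceOf (x : V) : kernelFun (x : UnitBall E) ∈ subspaceOf V :=
  Submodule.le_topologicalClosure _ (Submodule.subset_span ⟨x, x.2, rfl⟩)

theorem eq_zero_of_mem_subspaceOf {h : Space E} (hmem : h ∈ subspaceOf V)
    (hzero : ∀ x ∈ V, h x = 0) : h = 0 := by
  have hle : subspaceOf V ≤ (ℂ ∙ h)ᗮ := by
    refine Submodule.topologicalClosure_minimal _ (Submodule.span_le.mpr ?_)
      (Submodule.isClosed_orthogonal _)
    rintro _ ⟨x, hx, rfl⟩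
    rw [SetLike.mem_coe, Submodule.mem_orthogonal_singleton_iff_inner_left, inner_kernelFun_left,
      hzero x hx]
  exact inner_self_eq_zero.mp (Submodule.mem_orthogonal_singleton_iff_inner_left.mp (hle hmem))

instance : CompleteSpace (subspaceOf V) :=
  (Submodule.isClosed_topologicalClosure _).completeSpace_coe

variable (V) in
/-- Elements of `H_V` as functions on `V`. -/
def restrictCLM : subspaceOf V →L[ℂ] V → ℂ :=
  .pi fun x => .proj (x : UnitBall E) ∘L RKHS.coeCLM ℂ ∘L (subspaceOf V).subtypeL

theorem restrictCLM_injective : Function.Injective (restrictCLM V) :=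
  (injective_iff_map_eq_zero _).mpr fun h hzero =>
    Subtype.ext (eq_zero_of_mem_subspaceOf h.2 fun x hx => congrFun hzero ⟨x, hx⟩)

instance : RKHS ℂ (subspaceOf V) V ℂ where
  coeCLM := restrictCLM V
  coeCLM_injective := restrictCLM_injective

theorem functionsOf_subspaceOf : functionsOf (subspaceOf V) = functionsOn V := by
  ext f
  exact ⟨fun ⟨h, hf⟩ => ⟨h, h.2, hf⟩, fun ⟨h, hmem, hf⟩ => ⟨⟨h, hmem⟩, hf⟩⟩

theorem kernelAt_subspaceOf (x : V) :
    kernelAt (subspaceOf V) x = ⟨kernelFun x, kernelFun_mem_subspaceOf x⟩ :=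
  ext_inner_right ℂ fun h => by
    rw [inner_kernelAt_left, Submodule.coe_inner, inner_kernelFun_left]
    rfl

theorem kernelAt_subspaceOf_apply (x y : V) :
    kernelAt (subspaceOf V) x y = (1 - ⟪(x : E), (y : E)⟫_ℂ)⁻¹ := by
  rw [kernelAt_subspaceOf, ← one_div]
  exact kernelFun_apply _ _

theorem kernelAt_subspaceOf_ne_zero (x : V) : kernelAt (subspaceOf V) x ≠ 0 := fun h => by
  have happly := kernelAt_subspaceOf_apply x x
  rw [h, RKHS.coe_zero] at happly
  exact inv_ne_zero (one_sub_inner_ne_zero _ _) happly.symm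

theorem norm_kernelAt_subspaceOf_sq (x : V) :
    ‖kernelAt (subspaceOf V) x‖ ^ 2 = (1 - ‖(x : E)‖ ^ 2)⁻¹ := by
  have hself := kernelAt_self (H := subspaceOf V) x
  rw [kernelAt_subspaceOf_apply, inner_self_eq_norm_sq_to_K] at hself
  simp only [Complex.coe_algebraMap] at hself
  exact_mod_cast hself.symm

theorem kernelDist_subspaceOf (x y : V) :
    kernelDist (subspaceOf V) x y = pseudohyperbolicDist (x : UnitBall E) y := by
  have hnonneg : 0 ≤ pseudohyperbolicDist (x : UnitBall E) y := norm_nonneg _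
  refine (sq_eq_sq₀ (kernelDist_nonneg x y) hnonneg).mp ?_
  rw [kernelDist_sq (kernelAt_subspaceOf_ne_zero x), pseudohyperbolicDist_sq,
    kernelAt_subspaceOf_apply, norm_kernelAt_subspaceOf_sq, norm_kernelAt_subspaceOf_sq, norm_inv,
    inv_pow, ← mul_inv, div_inv_eq_mul, inv_mul_eq_div]

theorem isContractiveMultiplier_ballAut (a : UnitBall E) :
    IsContractiveMultiplier (subspaceOf V) fun x : V => ballAut (a : E) (x : E) := by
  unfold IsContractiveMultiplier
  convert! posSemidef_gram ℂ fun x : V =>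
    (√(1 - ‖(a : E)‖ ^ 2) : ℂ) * (1 - ⟪(x : E), (a : E)⟫_ℂ)⁻¹ using 1
  ext x y
  have hyx := one_sub_inner_ne_zero (y : UnitBall E) (x : UnitBall E)
  simp only [Matrix.hadamard_apply, Matrix.of_apply, Matrix.gram_apply, inner_kernelAt_left,
    kernelAt_subspaceOf_apply, one_sub_inner_ballAut, ← sqrt_one_sub_norm_sq_mul_self,
    RCLike.inner_apply, map_mul, map_inv₀, map_sub, map_one, inner_conj_symm, Complex.conj_ofReal]
  field_simp

theorem hasTwoPointPickProperty_subspaceOf : HasTwoPointPickProperty (subspaceOf V) :=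
  hasTwoPointPickProperty_of_isContractiveMultiplier kernelAt_subspaceOf_ne_zero
    (fun y => isContractiveMultiplier_ballAut (y : UnitBall E)) (fun _ => ballAut_self _)
    fun x y => (kernelDist_subspaceOf x y).symm

end Varieties

end DruryArveson

end

theorem theoremT_general {E E' : Type*}
    [NormedAddCommGroup E] [InnerProductSpace ℂ E]
    [NormedAddCommGroup E'] [InnerProductSpace ℂ E']
    (V : Set (DruryArveson.UnitBall E)) (W : Set (DruryArveson.UnitBall E')) (F : W → V)
    (φ : DruryArveson.multiplierAlgebra V → DruryArveson.multiplierAlgebra W)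
    (hφ : ∀ f : DruryArveson.multiplierAlgebra V,
      (φ f : W → ℂ) = (f : V → ℂ) ∘ F)
    (hφ_surj : Function.Surjective φ) :
    ∃ c C : ℝ, 0 < c ∧ 0 < C ∧ ∀ l m : W,
      c * DruryArveson.pseudohyperbolicDist (l : DruryArveson.UnitBall E') m ≤
          DruryArveson.pseudohyperbolicDist (F l : DruryArveson.UnitBall E) (F m) ∧
        DruryArveson.pseudohyperbolicDist (F l : DruryArveson.UnitBall E) (F m) ≤
          C * DruryArveson.pseudohyperbolicDist (l : DruryArveson.UnitBall E') m := by
  open DruryArveson in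
  have hmaps : ∀ f ∈ multipliers (functionsOf (subspaceOf V)),
      f ∘ F ∈ multipliers (functionsOf (subspaceOf W)) := by
    simp only [functionsOf_subspaceOf]
    exact fun f hf => hφ ⟨f, hf⟩ ▸ (φ ⟨f, hf⟩).2
  have hsurj : ∀ g ∈ multipliers (functionsOf (subspaceOf W)),
      ∃ f ∈ multipliers (functionsOf (subspaceOf V)), f ∘ F = g := by
    simp only [functionsOf_subspaceOf]
    intro g hg
    obtain ⟨f, hf⟩ := hφ_surj ⟨g, hg⟩
    exact ⟨f, f.2, by rw [← hφ, hf]⟩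
  obtain ⟨c, hc, hlower⟩ := exists_le_kernelDist_comp kernelAt_subspaceOf_ne_zero
    kernelAt_subspaceOf_ne_zero hasTwoPointPickProperty_subspaceOf hmaps hsurj
  obtain ⟨C, hC, hupper⟩ := exists_kernelDist_comp_le kernelAt_subspaceOf_ne_zero
    kernelAt_subspaceOf_ne_zero hasTwoPointPickProperty_subspaceOf hmaps
  simp only [kernelDist_subspaceOf] at hlower hupper
  exact ⟨c, C, hc, hC, fun l m => ⟨hlower l m, hupper l m⟩⟩

theorem theoremT {E E' : Type*}
    [NormedAddCommGroup E] [InnerProductSpace ℂ E] [CompleteSpace E]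
    [NormedAddCommGroup E'] [InnerProductSpace ℂ E'] [CompleteSpace E']
    (V : Set (DruryArveson.UnitBall E)) (W : Set (DruryArveson.UnitBall E'))
    (hV : DruryArveson.IsVariety V) (hW : DruryArveson.IsVariety W)
    (F : W ≃ V) (hF : DruryArveson.IsBiholomorphism F)
    (φ : DruryArveson.multiplierAlgebra V ≃ₐ[ℂ] DruryArveson.multiplierAlgebra W)
    (hφ : ∀ f : DruryArveson.multiplierAlgebra V,
      (φ f : W → ℂ) = (f : V → ℂ) ∘ F) :
    ∃ c C : ℝ, 0 < c ∧ 0 < C ∧ ∀ l m : W,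
      c * DruryArveson.pseudohyperbolicDist (l : DruryArveson.UnitBall E') m ≤
          DruryArveson.pseudohyperbolicDist (F l : DruryArveson.UnitBall E) (F m) ∧
        DruryArveson.pseudohyperbolicDist (F l : DruryArveson.UnitBall E) (F m) ≤
          C * DruryArveson.pseudohyperbolicDist (l : DruryArveson.UnitBall E') m :=
  theoremT_general V W F φ hφ φ.surjective
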